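/- All rings are associative with unity. A ring $R$ is \emph{reversible} if $ab=0$ implies $ba=0$ for all $a,b\in R$; it is \emph{$i$-reversible} if, for all $a,b\in R$, whenever $ab$ is a non-zero idempotent, $ba$ is idempotent. $R$ is \emph{left McCoy} if for all non-zero $f(x),g(x)\in R[x]$ with $f(x)g(x)=0$ there is a non-zero $s\in R$ with $s\,g(x)=0$; it is \emph{right McCoy} if for all such $f,g$ there is a non-zero $t\in R$ with $f(x)\,t=0$; it is \emph{McCoy} if it is both left and right McCoy. $R$ is \emph{inner McCoy} if for all non-zero $f(x),g(x)\in R[x]$ with $f(x)g(x)f(x)=0$ there is a non-zero $r\in R$ with $f(x)\,r\,f(x)=0$. For $n\ge 1$, let $DUT_n(R)$ denote the ring of upper triangular $n\times n$ matrices over $R$ all of whose diagonal entries are equal. Let $L=\mathbb{Z}_2\langle c_0,c_1,d_0,d_1\rangle$ be the free associative unital algebra over $\mathbb{Z}_2=\mathbb{Z}/2\mathbb{Z}$, let $J$ be the two-sided ideal $$J=\langle c_0d_0,\ c_0d_1+c_1d_0,\ c_1d_1,\ d_id_j\ (0\le i,j\le 1),\ d_ic_j\ (0\le i,j\le 1)\rangle$$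 of $L$, and let $S=L/J$. Then for every integer $n\ge 2$ the ring $DUT_n(S)$ is not reversible, is $i$-reversible, is not McCoy, and is inner McCoy. -/

import Mathlib

/-- Left McCoy ring: whenever `f * g = 0` for nonzero `f, g ∈ R[x]`, some nonzero `s ∈ R`
satisfies `s g(x) = 0`. -/
def IsLeftMcCoy (R : Type*) [Ring R] : Prop :=
  ∀ f g : Polynomial R, f ≠ 0 → g ≠ 0 → f * g = 0 → ∃ s : R, s ≠ 0 ∧ Polynomial.C s * g = 0

/-- Right McCoy ring: whenever `f * g = 0` for nonzero `f, g ∈ R[x]`, some nonzero `t ∈ R`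
satisfies `f(x) t = 0`. -/
def IsRightMcCoy (R : Type*) [Ring R] : Prop :=
  ∀ f g : Polynomial R, f ≠ 0 → g ≠ 0 → f * g = 0 → ∃ t : R, t ≠ 0 ∧ f * Polynomial.C t = 0

/-- McCoy ring: both left and right McCoy. -/
def IsMcCoy (R : Type*) [Ring R] : Prop :=
  IsLeftMcCoy R ∧ IsRightMcCoy R

/-- Inner McCoy ring: whenever `f * g * f = 0` for nonzero `f, g ∈ R[x]`, some nonzero `r ∈ R`
satisfies `f(x) r f(x) = 0`. -/
def IsInnerMcCoy (R : Type*) [Ring R] : Prop :=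
  ∀ f g : Polynomial R, f ≠ 0 → g ≠ 0 → f * g * f = 0 →
    ∃ r : R, r ≠ 0 ∧ f * Polynomial.C r * f = 0

/-- Reversible ring: `a * b = 0` implies `b * a = 0`. -/
def IsReversibleRing (R : Type*) [Ring R] : Prop :=
  ∀ a b : R, a * b = 0 → b * a = 0

/-- `i`-reversible ring: if `a * b` is a nonzero idempotent, then `b * a` is idempotent. -/
def IsIReversibleRing (R : Type*) [Ring R] : Prop :=
  ∀ a b : R, a * b ≠ 0 → IsIdempotentElem (a * b) → IsIdempotentElem (b * a)

/-- `DUT n R`: the ring of upper triangular `n × n` matrices over `R` with all diagonal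
entries equal, as a subring of the full matrix ring. -/
def DUT (n : ℕ) (R : Type*) [Ring R] : Subring (Matrix (Fin n) (Fin n) R) where
  carrier := {A | (∀ i j, j < i → A i j = 0) ∧ ∀ i j, A i i = A j j}
  zero_mem' := ⟨fun _ _ _ => rfl, fun _ _ => rfl⟩
  one_mem' := ⟨fun _ _ h => Matrix.one_apply_ne h.ne', fun i j => by simp⟩
  add_mem' := by
    rintro A B ⟨hA, hA'⟩ ⟨hB, hB'⟩
    exact ⟨fun i j h => by simp [hA i j h, hB i j h], fun i j => by simp [hA' i j, hB' i j]⟩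
  neg_mem' := by
    rintro A ⟨hA, hA'⟩
    exact ⟨fun i j h => by simp [hA i j h], fun i j => by simp [hA' i j]⟩
  mul_mem' := by
    rintro A B ⟨hA, hA'⟩ ⟨hB, hB'⟩
    have key : ∀ i, (A * B) i i = A i i * B i i := by
      intro i
      rw [Matrix.mul_apply]
      refine Finset.sum_eq_single i (fun k _ hk => ?_) (by simp)
      rcases lt_or_gt_of_ne hk with h | h
      · rw [hA i k h, zero_mul]
      · rw [hB k i h, mul_zero]
    refine ⟨fun i j h => ?_, fun i j => by rw [key, key, hA' i j, hB' i j]⟩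
    rw [Matrix.mul_apply]
    refine Finset.sum_eq_zero fun k _ => ?_
    rcases lt_or_ge k i with h' | h'
    · rw [hA i k h', zero_mul]
    · rw [hB k j (h.trans_le h'), mul_zero]

namespace ExampleRing

/-- The four free generators: `c 0, c 1, d 0, d 1`. -/
inductive Gen : Type
  | c (i : Fin 2) : Gen
  | d (i : Fin 2) : Gen

/-- The free associative unital algebra `L = ℤ₂⟨c₀, c₁, d₀, d₁⟩`. -/
abbrev L : Type := FreeAlgebra (ZMod 2) Gen

/-- The generator `cᵢ` of `L`. -/
def c (i : Fin 2) : L := FreeAlgebra.ι (ZMod 2) (Gen.c i)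

/-- The generator `dᵢ` of `L`. -/
def d (i : Fin 2) : L := FreeAlgebra.ι (ZMod 2) (Gen.d i)

/-- The two-sided ideal
`J = ⟨c₀d₀, c₀d₁ + c₁d₀, c₁d₁, dᵢdⱼ (0 ≤ i, j ≤ 1), dᵢcⱼ (0 ≤ i, j ≤ 1)⟩` of `L`. -/
def J : TwoSidedIdeal L :=
  TwoSidedIdeal.span
    ({c 0 * d 0, c 0 * d 1 + c 1 * d 0, c 1 * d 1} ∪
      {x | ∃ i j : Fin 2, x = d i * d j} ∪ {x | ∃ i j : Fin 2, x = d i * c j})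

/-- The quotient ring `S = L / J`. -/
abbrev S : Type := J.ringCon.Quotient

end ExampleRing

/-!
The ring `S` has an augmentation to `𝔽₂` and a faithful representation by upper triangular
matrices over the free algebra `A = 𝔽₂⟨x₀, x₁⟩`, in which every diagonal entry has the same
augmentation as the represented element. Since `A[X]` has no zero divisors, every polynomial over
`S` with nonzero augmentation is represented by a triangular matrix with regular diagonal, hence is
regular. Triangularity passes this property on to `DUTₙ(S)`. It leaves only the trivial idempotents,
so the ring is `i`-reversible; and `fgf = 0` with `g ≠ 0` forces `f` to have zero augmentation, so
that the matrix with `d₀` in its corner kills `f`. On the other hand, `d₁c₀ = 0 ≠ c₀d₁`, and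
`(c₀ + c₁X)(d₀ + d₁X) = 0` although no nonzero element is annihilated by both `c₀` and `c₁`.
-/

open Polynomial

section UpperTriangular

variable {ι B R : Type*} [Fintype ι] [LinearOrder ι]

theorem isUpperTriangular_mul_apply_self [NonUnitalNonAssocSemiring B] {M N : Matrix ι ι B}
    (hM : M.IsUpperTriangular) (hN : N.IsUpperTriangular) (i : ι) :
    (M * N) i i = M i i * N i i := by
  rw [Matrix.mul_apply]
  refine Finset.sum_eq_single i (fun k _ hk => ?_) (by simp)
  rcases hk.lt_or_gt with hki | hik
  · rw [hM hki, zero_mul]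
  · rw [hN hik, mul_zero]

theorem isLeftRegular_of_isUpperTriangular [Ring B] {M : Matrix ι ι B}
    (hM : M.IsUpperTriangular) (hdiag : ∀ i, IsLeftRegular (M i i)) : IsLeftRegular M := by
  refine isLeftRegular_of_non_zero_divisor M fun N hMN => ?_
  ext i j
  induction i using WellFoundedGT.induction with
  | ind i ih =>
    have hij : M i i * N i j = 0 := by
      rw [← Matrix.zero_apply i j, ← hMN, Matrix.mul_apply, Finset.sum_eq_single i _ (by simp)]
      intro k _ hk
      rcases hk.lt_or_gt with hki | hik
      · rw [hM hki, zero_mul]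
      · rw [ih k hik, Matrix.zero_apply, mul_zero]
    exact (hdiag i).mul_left_eq_zero_iff.1 hij

theorem isRightRegular_of_isUpperTriangular [Ring B] {M : Matrix ι ι B}
    (hM : M.IsUpperTriangular) (hdiag : ∀ i, IsRightRegular (M i i)) : IsRightRegular M := by
  refine isRightRegular_of_non_zero_divisor M fun N hNM => ?_
  ext i j
  induction j using WellFoundedLT.induction with
  | ind j ih =>
    have hij : N i j * M j j = 0 := by
      rw [← Matrix.zero_apply i j, ← hNM, Matrix.mul_apply, Finset.sum_eq_single j _ (by simp)]
      intro k _ hk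
      rcases hk.lt_or_gt with hkj | hjk
      · rw [ih k hkj, Matrix.zero_apply, zero_mul]
      · rw [hM hjk, mul_zero]
    exact (hdiag j).mul_right_eq_zero_iff.1 hij

variable [Semiring B] [Semiring R]

/-- The `i`-th diagonal entry of a representation by upper triangular matrices, as a ring
homomorphism. -/
def diagHom (ρ : R →+* Matrix ι ι B) (hρ : ∀ r, (ρ r).IsUpperTriangular) (i : ι) : R →+* B where
  toFun r := ρ r i i
  map_one' := by simp
  map_mul' r s := by rw [map_mul, isUpperTriangular_mul_apply_self (hρ r) (hρ s)]
  map_zero' := by simp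
  map_add' r s := by simp

theorem diagHom_apply (ρ : R →+* Matrix ι ι B) (hρ : ∀ r, (ρ r).IsUpperTriangular) (i : ι)
    (r : R) : diagHom ρ hρ i r = ρ r i i := rfl

end UpperTriangular

section PolyToMatrix

variable {ι B R : Type*} [Fintype ι] [DecidableEq ι] [Semiring B] [Semiring R]

/-- The extension of a representation `ρ : R → Mᵢ(B)` to polynomials, `R[X] → Mᵢ(B[X])`. It differs
from Mathlib's `RingHom.polyToMatrix` in that `B` need not be commutative. -/
noncomputable def polyToMatrix (ρ : R →+* Matrix ι ι B) : R[X] →+* Matrix ι ι B[X] :=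
  eval₂RingHom' ((C : B →+* B[X]).mapMatrix.comp ρ) (Matrix.scalar ι X)
    fun _ => (Matrix.scalar_commute X commute_X _).symm

theorem coeff_polyToMatrix (ρ : R →+* Matrix ι ι B) (p : R[X]) (i j : ι) (k : ℕ) :
    (polyToMatrix ρ p i j).coeff k = ρ (p.coeff k) i j := by
  induction p using Polynomial.induction_on' with
  | add p q hp hq => simp only [map_add, Matrix.add_apply, coeff_add, hp, hq]
  | monomial m r =>
    simp only [polyToMatrix, eval₂RingHom'_apply, eval₂_monomial, ← map_pow]
    simp only [Matrix.scalar_apply, Matrix.mul_diagonal, RingHom.comp_apply,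
      RingHom.mapMatrix_apply, Matrix.map_apply, coeff_C_mul_X_pow, coeff_monomial]
    rcases eq_or_ne k m with rfl | hkm
    · simp
    · simp [hkm, hkm.symm]

theorem polyToMatrix_injective {ρ : R →+* Matrix ι ι B} (hρ : Function.Injective ρ) :
    Function.Injective (polyToMatrix ρ) := by
  intro p q hpq
  ext k
  apply hρ
  ext i j
  rw [← coeff_polyToMatrix, hpq, coeff_polyToMatrix]

end PolyToMatrix

section DetectsRegular

variable {R K : Type*} [Ring R] [Semiring K]

/-- A ring homomorphism detects regularity if every polynomial over its source with nonzero image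
is regular. Polynomials appear instead of elements because it is over `R[X]` that the McCoy
conditions are tested; constant polynomials give the corresponding property of elements. -/
def DetectsRegular (φ : R →+* K) : Prop :=
  ∀ f : R[X], f.map φ ≠ 0 → IsRegular f

namespace DetectsRegular

variable {φ : R →+* K}

theorem isRegular (hφ : DetectsRegular φ) {r : R} (hr : φ r ≠ 0) : IsRegular r := by
  have hC : IsRegular (C r) := hφ (C r) (by rwa [map_C, C_ne_zero])
  exact ⟨fun a b hab => C_injective (hC.left (by simpa only [C_mul] using congrArg C hab)),
    fun a b hab => C_injective (hC.right (by simpa only [C_mul] using congrArg C hab))⟩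

theorem eq_zero_or_eq_one_of_isIdempotentElem [Nontrivial K] (hφ : DetectsRegular φ) {e : R}
    (he : IsIdempotentElem e) : e = 0 ∨ e = 1 := by
  by_cases hφe : φ e = 0
  · have hφ' : φ (1 - e) ≠ 0 := fun h => one_ne_zero <| by
      rw [← map_one φ, ← sub_add_cancel 1 e, map_add, h, hφe, add_zero]
    exact .inl ((hφ.isRegular hφ').left.mul_left_eq_zero_iff.1 he.one_sub_mul_self)
  · exact .inr ((hφ.isRegular hφe).left (he.eq.trans (mul_one e).symm))

theorem isIReversibleRing [Nontrivial K] (hφ : DetectsRegular φ) : IsIReversibleRing R := by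
  intro a b hab he
  have hab_one : a * b = 1 := (hφ.eq_zero_or_eq_one_of_isIdempotentElem he).resolve_left hab
  rw [IsIdempotentElem, mul_assoc, ← mul_assoc a, hab_one, one_mul]

theorem isInnerMcCoy (hφ : DetectsRegular φ) {r : R} (hr : r ≠ 0)
    (hker : ∀ s, φ s = 0 → r * s = 0) : IsInnerMcCoy R := by
  intro f g _ hg hfgf
  by_cases hf : f.map φ = 0
  · refine ⟨r, hr, ?_⟩
    have hrf : C r * f = 0 := by
      ext k
      rw [coeff_C_mul, hker _ (by rw [← coeff_map, hf, coeff_zero]), coeff_zero]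
    rw [mul_assoc, hrf, mul_zero]
  · have hfg : f * g = 0 := (hφ f hf).right.mul_right_eq_zero_iff.1 hfgf
    exact absurd ((hφ f hf).left.mul_left_eq_zero_iff.1 hfg) hg

theorem of_isUpperTriangular {ι B : Type*} [Fintype ι] [LinearOrder ι] [Ring B]
    {ρ : R →+* Matrix ι ι B} (hinj : Function.Injective ρ) (hρ : ∀ r, (ρ r).IsUpperTriangular)
    (hdiag : ∀ i (f : R[X]), f.map φ ≠ 0 → IsRegular (f.map (diagHom ρ hρ i))) :
    DetectsRegular φ := by
  intro f hf
  have htri : (polyToMatrix ρ f).IsUpperTriangular := fun i j hji => by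
    ext k
    rw [coeff_polyToMatrix, hρ _ hji, coeff_zero]
  have hregular : ∀ i, IsRegular (polyToMatrix ρ f i i) := fun i => by
    convert hdiag i f hf using 1
    ext k
    rw [coeff_polyToMatrix, coeff_map, diagHom_apply]
  have hzero : ∀ g, polyToMatrix ρ g = 0 → g = 0 := fun g =>
    (map_eq_zero_iff _ (polyToMatrix_injective hinj)).1
  constructor
  · refine isLeftRegular_of_non_zero_divisor f fun g hfg => hzero g ?_
    rw [← (isLeftRegular_of_isUpperTriangular htri fun i => (hregular i).left).mul_left_eq_zero_iff,
      ← map_mul, hfg, map_zero]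
  · refine isRightRegular_of_non_zero_divisor f fun g hgf => hzero g ?_
    rw [← (isRightRegular_of_isUpperTriangular htri
      fun i => (hregular i).right).mul_right_eq_zero_iff, ← map_mul, hgf, map_zero]

end DetectsRegular

end DetectsRegular

namespace DUT

variable {n : ℕ} {R : Type*} [Ring R]

theorem isUpperTriangular_subtype (A : DUT n R) : ((DUT n R).subtype A).IsUpperTriangular :=
  fun i j => A.2.1 i j

/-- The embedding of `R` into `DUT n R` as scalar matrices. -/
def scalar (n : ℕ) (R : Type*) [Ring R] : R →+* DUT n R :=
  (Matrix.scalar (Fin n)).codRestrict (DUT n R) fun _ =>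
    ⟨fun _ _ hji => Matrix.diagonal_apply_ne _ hji.ne', fun _ _ => by simp⟩

theorem scalar_mul_apply (r : R) (A : DUT n R) (i j : Fin n) :
    (scalar n R r * A).1 i j = r * A.1 i j :=
  Matrix.diagonal_mul _ _ _ _

variable [NeZero n]

theorem scalar_injective : Function.Injective (scalar n R) := fun _ _ hrs =>
  Matrix.scalar_inj.1 (congrArg Subtype.val hrs)

/-- The common diagonal entry of a matrix in `DUT n R`. -/
def diag (n : ℕ) [NeZero n] (R : Type*) [Ring R] : DUT n R →+* R :=
  diagHom (DUT n R).subtype isUpperTriangular_subtype 0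

theorem apply_self_eq_diag (A : DUT n R) (i : Fin n) : A.1 i i = diag n R A := A.2.2 i 0

/-- The matrix in `DUT n R` with `r` in the upper right corner and zeros elsewhere; it is the
`1 × 1` matrix `r` when `n = 1`. -/
noncomputable def corner (n : ℕ) [NeZero n] (r : R) : DUT n R :=
  ⟨Matrix.single ⊥ ⊤ r, fun _ _ hji => Matrix.blockTriangular_single (b := id) bot_le r hji, by
    have hdiag : ∀ i : Fin n, Matrix.single ⊥ ⊤ r i i =
        if (⊥ : Fin n) = ⊤ then r else 0 := fun i => by
      by_cases h : (⊥ : Fin n) = ⊤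
      · have := subsingleton_of_bot_eq_top h
        simp [Matrix.single_apply, eq_iff_true_of_subsingleton]
      · rw [Matrix.single_apply, if_neg h, if_neg fun hi => h (hi.1.trans hi.2.symm)]
    exact fun i j => (hdiag i).trans (hdiag j).symm⟩

theorem corner_eq_zero_iff {r : R} : corner n r = 0 ↔ r = 0 := by
  refine ⟨fun h => ?_, fun h => Subtype.ext ?_⟩
  · simpa [corner] using congrArg (fun A : DUT n R => A.1 ⊥ ⊤) h
  · rw [h]
    exact Matrix.single_zero _ _

theorem corner_mul (r : R) (A : DUT n R) : corner n r * A = corner n (r * diag n R A) := by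
  ext i j
  change (Matrix.single (⊥ : Fin n) (⊤ : Fin n) r * A.1) i j =
    Matrix.single (⊥ : Fin n) (⊤ : Fin n) (r * diag n R A) i j
  rcases eq_or_ne i ⊥ with rfl | hi
  · rw [Matrix.single_mul_apply_same]
    rcases eq_or_ne j ⊤ with rfl | hj
    · rw [Matrix.single_apply_same, apply_self_eq_diag]
    · rw [Matrix.single_apply_of_ne _ _ _ _ _ fun h => hj h.2.symm, A.2.1 _ _ hj.lt_top, mul_zero]
  · rw [Matrix.single_mul_apply_of_ne _ _ _ _ _ hi,
      Matrix.single_apply_of_ne _ _ _ _ _ fun h => hi h.1.symm]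

end DUT

theorem DetectsRegular.comp_diag {n : ℕ} [NeZero n] {R K : Type*} [Ring R] [Semiring K]
    {φ : R →+* K} (hφ : DetectsRegular φ) : DetectsRegular (φ.comp (DUT.diag n R)) := by
  refine .of_isUpperTriangular (DUT n R).subtype_injective DUT.isUpperTriangular_subtype
    fun i f hf => ?_
  have hdiag : diagHom (DUT n R).subtype DUT.isUpperTriangular_subtype i = DUT.diag n R :=
    RingHom.ext fun A => DUT.apply_self_eq_diag A i
  rw [hdiag]
  exact hφ _ (by rwa [Polynomial.map_map])

theorem IsReversibleRing.of_injective {R T : Type*} [Ring R] [Ring T] {f : R →+* T}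
    (hf : Function.Injective f) (hT : IsReversibleRing T) : IsReversibleRing R := by
  intro a b hab
  apply hf
  rw [map_mul, map_zero]
  exact hT _ _ (by rw [← map_mul, hab, map_zero])

theorem IsRightMcCoy.of_dut {n : ℕ} [NeZero n] {R : Type*} [Ring R]
    (h : IsRightMcCoy (DUT n R)) : IsRightMcCoy R := by
  intro f g hf hg hfg
  obtain ⟨t, ht, hft⟩ := h (f.map (DUT.scalar n R)) (g.map (DUT.scalar n R))
    ((Polynomial.map_ne_zero_iff DUT.scalar_injective).2 hf)
    ((Polynomial.map_ne_zero_iff DUT.scalar_injective).2 hg)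
    (by rw [← Polynomial.map_mul, hfg, Polynomial.map_zero])
  obtain ⟨i, j, hij⟩ : ∃ i j, t.1 i j ≠ 0 := by
    by_contra! hzero
    exact ht (Subtype.ext (Matrix.ext hzero))
  refine ⟨t.1 i j, hij, ?_⟩
  ext k
  have hk : DUT.scalar n R (f.coeff k) * t = 0 := by
    rw [← coeff_map, ← coeff_mul_C, hft, coeff_zero]
  rw [coeff_mul_C, ← DUT.scalar_mul_apply, hk, coeff_zero]
  rfl

theorem C_add_C_mul_X_mul {R : Type*} [Semiring R] (a b a' b' : R) :
    (C a + C b * X) * (C a' + C b' * X) =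
      C (a * a') + C (a * b' + b * a') * X + C (b * b') * X ^ 2 := by
  have hX : ∀ r : R, X * C r = C r * X := fun r => X_mul_C r
  have hX' : ∀ (r : R) (p : R[X]), X * (C r * p) = C r * (X * p) := fun r p => by
    rw [← mul_assoc, hX, mul_assoc]
  simp only [C_add, C_mul, add_mul, mul_add, mul_assoc, hX, hX', sq]
  abel

namespace ExampleRing

/-- The free algebra on two generators. It is the subalgebra of `S` generated by `c 0` and `c 1`. -/
abbrev A : Type := FreeAlgebra (ZMod 2) (Fin 2)

/-- The generators of `A`. -/
def x (i : Fin 2) : A := FreeAlgebra.ι (ZMod 2) i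

theorem x_ne_zero (i : Fin 2) : x i ≠ 0 := FreeAlgebra.ι_ne_zero i

theorem algebraMapInv_x (i : Fin 2) : FreeAlgebra.algebraMapInv (x i) = 0 := by
  simp [x, FreeAlgebra.algebraMapInv]

/-- The quotient map `L → S`. -/
def mk : L →ₐ[ZMod 2] S := J.ringCon.mkₐ (ZMod 2)

theorem mk_surjective : Function.Surjective mk := J.ringCon.mkₐ_surjective

theorem mk_eq_zero_of_mem {y : L} (hy : y ∈ J) : mk y = 0 := J.ringCon.eq.2 hy

theorem mk_c_mul_mk_d (i : Fin 2) : mk (c i) * mk (d i) = 0 := by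
  rw [← map_mul]
  refine mk_eq_zero_of_mem (TwoSidedIdeal.subset_span ?_)
  fin_cases i <;> simp

theorem mk_c_mul_mk_d_add : mk (c 0) * mk (d 1) + mk (c 1) * mk (d 0) = 0 := by
  rw [← map_mul, ← map_mul, ← map_add]
  exact mk_eq_zero_of_mem (TwoSidedIdeal.subset_span (by simp))

theorem mk_d_mul_mk_ι (i : Fin 2) (g : Gen) : mk (d i) * mk (FreeAlgebra.ι _ g) = 0 := by
  rw [← map_mul]
  refine mk_eq_zero_of_mem (TwoSidedIdeal.subset_span ?_)
  rcases g with j | j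
  · exact .inr ⟨i, j, rfl⟩
  · exact .inl (.inr ⟨i, j, rfl⟩)

/-- The element `c₀d₁ = c₁d₀` of `S`; the two products agree because the characteristic is two. -/
def w : S := mk (c 0) * mk (d 1)

theorem mk_c_mul_mk_d_rev (i : Fin 2) : mk (c i) * mk (d i.rev) = w := by
  fin_cases i
  · rfl
  · exact (eq_neg_of_add_eq_zero_right mk_c_mul_mk_d_add).trans (ZModModule.neg_eq_self _)

section Lift

variable {B : Type*} [Ring B] [Algebra (ZMod 2) B]

theorem J_le_ker {f : L →ₐ[ZMod 2] B} (hcd : ∀ i, f (c i) * f (d i) = 0)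
    (hcd_add : f (c 0) * f (d 1) + f (c 1) * f (d 0) = 0)
    (hd : ∀ i g, f (d i) * f (FreeAlgebra.ι _ g) = 0) : J ≤ TwoSidedIdeal.ker f := by
  refine TwoSidedIdeal.span_le.2 ?_
  rintro y (((rfl | rfl | rfl) | ⟨i, j, rfl⟩) | ⟨i, j, rfl⟩) <;>
    simp only [SetLike.mem_coe, TwoSidedIdeal.mem_ker, map_add, map_mul]
  exacts [hcd 0, hcd_add, hcd 1, hd i _, hd i _]

/-- The algebra homomorphism out of `S` induced by one out of `L` that respects the relations. -/
def lift (f : L →ₐ[ZMod 2] B) (hcd : ∀ i, f (c i) * f (d i) = 0)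
    (hcd_add : f (c 0) * f (d 1) + f (c 1) * f (d 0) = 0)
    (hd : ∀ i g, f (d i) * f (FreeAlgebra.ι _ g) = 0) : S →ₐ[ZMod 2] B :=
  J.ringCon.liftₐ f (TwoSidedIdeal.ringCon_le_iff.1 (J_le_ker hcd hcd_add hd))

end Lift

/-- The augmentation of `S`, which kills all four generators. -/
def augmentation : S →ₐ[ZMod 2] ZMod 2 :=
  lift FreeAlgebra.algebraMapInv (by simp [c, FreeAlgebra.algebraMapInv])
    (by simp [c, FreeAlgebra.algebraMapInv]) (by simp [d, FreeAlgebra.algebraMapInv])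

theorem augmentation_mk_ι (g : Gen) : augmentation (mk (FreeAlgebra.ι _ g)) = 0 := by
  change FreeAlgebra.algebraMapInv (FreeAlgebra.ι (ZMod 2) g) = 0
  simp [FreeAlgebra.algebraMapInv]

theorem mk_d_mul (i : Fin 2) (s : S) : mk (d i) * s = augmentation s • mk (d i) := by
  obtain ⟨y, rfl⟩ := mk_surjective s
  induction y using FreeAlgebra.induction with
  | grade0 r => simp [Algebra.smul_def, Algebra.commutes]
  | grade1 g => rw [mk_d_mul_mk_ι, augmentation_mk_ι, zero_smul]
  | mul y z hy hz => rw [map_mul, ← mul_assoc, hy, smul_mul_assoc, hz, smul_smul, map_mul]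
  | add y z hy hz => rw [map_add, mul_add, hy, hz, map_add, add_smul]

section NormalForm

/-- The inclusion of `A` into `S`. -/
def incl : A →ₐ[ZMod 2] S := FreeAlgebra.lift (ZMod 2) fun i => mk (c i)

theorem incl_x (i : Fin 2) : incl (x i) = mk (c i) := by simp [incl, x]

/-- The coordinates of `S` as a vector space: `(a, r, b)` stands for `a + r₀d₀ + r₁d₁ + bw`. -/
def normalForm : A × (Fin 2 → ZMod 2) × A →ₗ[ZMod 2] S where
  toFun v := incl v.1 + ∑ i, v.2.1 i • mk (d i) + incl v.2.2 * w
  map_add' v v' := by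
    simp only [Prod.fst_add, Prod.snd_add, Pi.add_apply, map_add, add_smul, add_mul,
      Finset.sum_add_distrib]
    abel
  map_smul' r v := by
    simp only [Prod.smul_fst, Prod.smul_snd, Pi.smul_apply, map_smul, smul_assoc, smul_add,
      smul_mul_assoc, Finset.smul_sum, RingHom.id_apply]

theorem normalForm_apply (a : A) (r : Fin 2 → ZMod 2) (b : A) :
    normalForm (a, r, b) = incl a + ∑ i, r i • mk (d i) + incl b * w := rfl

theorem mk_c_mul_normalForm (i : Fin 2) (a : A) (r : Fin 2 → ZMod 2) (b : A) :
    mk (c i) * normalForm (a, r, b) =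
      normalForm (x i * a, 0, algebraMap _ _ (r i.rev) + x i * b) := by
  have hsum : mk (c i) * ∑ j, r j • mk (d j) = r i.rev • w := by
    rw [← mk_c_mul_mk_d_rev i, Finset.mul_sum, Finset.sum_eq_single i.rev _ (by simp),
      mul_smul_comm]
    intro j _ hj
    have hrev : ∀ i j : Fin 2, j ≠ i.rev → j = i := by decide
    rw [hrev i j hj]
    rw [mul_smul_comm, mk_c_mul_mk_d, smul_zero]
  simp only [normalForm_apply, mul_add, hsum, map_add, map_mul, incl_x, AlgHom.commutes,
    ← Algebra.smul_def, add_mul, mul_assoc, Pi.zero_apply, zero_smul, Finset.sum_const_zero,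
    add_zero]
  abel

theorem mk_d_eq_normalForm (i : Fin 2) : mk (d i) = normalForm (0, Pi.single i 1, 0) := by
  simp [normalForm_apply, Pi.single_apply]

theorem w_eq_normalForm : w = normalForm (0, 0, 1) := by simp [normalForm_apply]

theorem normalForm_surjective : Function.Surjective normalForm := by
  have hmul : ∀ y : L, ∀ s ∈ normalForm.range, mk y * s ∈ normalForm.range := by
    intro y
    induction y using FreeAlgebra.induction with
    | grade0 r =>
      intro s hs
      rw [AlgHom.commutes, ← Algebra.smul_def]
      exact Submodule.smul_mem _ r hs
    | grade1 g =>
      rintro _ ⟨⟨a, r, b⟩, rfl⟩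
      rcases g with i | i
      · exact ⟨_, (mk_c_mul_normalForm i a r b).symm⟩
      · change mk (d i) * _ ∈ _
        rw [mk_d_mul, mk_d_eq_normalForm]
        exact Submodule.smul_mem _ _ (LinearMap.mem_range_self _ _)
    | mul y z hy hz =>
      intro s hs
      rw [map_mul, mul_assoc]
      exact hy _ (hz s hs)
    | add y z hy hz =>
      intro s hs
      rw [map_add, add_mul]
      exact Submodule.add_mem _ (hy s hs) (hz s hs)
  have hone : (1 : S) ∈ normalForm.range := ⟨(1, 0, 0), by simp [normalForm_apply]⟩
  intro s
  obtain ⟨y, rfl⟩ := mk_surjective s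
  rw [← mul_one (mk y)]
  exact hmul y 1 hone

end NormalForm

section Representation

open Matrix (single)

/-- The matrices by which the generators act on the coordinates `b, r₀, r₁, e` of the element
`e + r₀d₀ + r₁d₁ + bw` of the left module `S/(Sc₀ + Sc₁)`. -/
def genMatrix : Gen → Matrix (Fin 4) (Fin 4) A
  | .c i => single 0 0 (x i) + single 0 (![2, 1] i) 1
  | .d i => single (![1, 2] i) 3 1

theorem genMatrix_c_mul_genMatrix_d (i j : Fin 2) :
    genMatrix (.c i) * genMatrix (.d j) = if i = j then 0 else single 0 3 1 := by
  fin_cases i <;> fin_cases j <;> simp [genMatrix, add_mul]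

theorem genMatrix_d_mul (i : Fin 2) (g : Gen) : genMatrix (.d i) * genMatrix g = 0 := by
  rcases g with j | j <;> fin_cases i <;> fin_cases j <;> simp [genMatrix, mul_add]

/-- The representation of `S` by matrices over `A` given by `genMatrix`. -/
def rep : S →ₐ[ZMod 2] Matrix (Fin 4) (Fin 4) A :=
  lift (FreeAlgebra.lift (ZMod 2) genMatrix)
    (fun i => by simp [c, d, genMatrix_c_mul_genMatrix_d])
    (by simp [c, d, genMatrix_c_mul_genMatrix_d, ZModModule.add_self])
    (fun i g => by simp [d, genMatrix_d_mul])

theorem rep_mk_ι (g : Gen) : rep (mk (FreeAlgebra.ι _ g)) = genMatrix g :=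
  FreeAlgebra.lift_ι_apply genMatrix g

theorem rep_w : rep w = single 0 3 1 := by
  rw [w, map_mul, c, d, rep_mk_ι, rep_mk_ι, genMatrix_c_mul_genMatrix_d, if_neg zero_ne_one]

theorem isUpperTriangular_rep (s : S) : (rep s).IsUpperTriangular := by
  obtain ⟨y, rfl⟩ := mk_surjective s
  induction y using FreeAlgebra.induction with
  | grade0 r =>
    rw [AlgHom.commutes, AlgHom.commutes]
    exact Matrix.blockTriangular_algebraMap r
  | grade1 g =>
    rw [rep_mk_ι]
    rcases g with i | i
    · exact (Matrix.blockTriangular_single (b := id) le_rfl _).add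
        (Matrix.blockTriangular_single (b := id) (Fin.zero_le _) _)
    · exact Matrix.blockTriangular_single (b := id) (Fin.le_last _) _
  | mul y z hy hz =>
    rw [map_mul, map_mul]
    exact hy.mul hz
  | add y z hy hz =>
    rw [map_add, map_add]
    exact hy.add hz

theorem algebraMapInv_rep_apply_self (s : S) (i : Fin 4) :
    FreeAlgebra.algebraMapInv (rep s i i) = augmentation s := by
  obtain ⟨y, rfl⟩ := mk_surjective s
  induction y using FreeAlgebra.induction with
  | grade0 r => simp [Matrix.algebraMap_matrix_apply]
  | grade1 g =>
    rw [rep_mk_ι, augmentation_mk_ι]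
    rcases g with j | j <;> fin_cases j <;> fin_cases i <;> simp [genMatrix, algebraMapInv_x]
  | mul y z hy hz =>
    rw [map_mul, map_mul rep, isUpperTriangular_mul_apply_self (isUpperTriangular_rep _)
      (isUpperTriangular_rep _), map_mul, hy, hz, map_mul]
  | add y z hy hz => simp only [map_add, Matrix.add_apply, hy, hz]

theorem rep_incl_zero_zero (a : A) : rep (incl a) 0 0 = a := by
  induction a using FreeAlgebra.induction with
  | grade0 r => simp [Matrix.algebraMap_matrix_apply]
  | grade1 i =>
    change rep (incl (x i)) 0 0 = x i
    rw [incl_x, c, rep_mk_ι]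
    fin_cases i <;> simp [genMatrix]
  | mul a b ha hb =>
    rw [map_mul, map_mul, isUpperTriangular_mul_apply_self (isUpperTriangular_rep _)
      (isUpperTriangular_rep _), ha, hb]
  | add a b ha hb => rw [map_add, map_add, Matrix.add_apply, ha, hb]

theorem rep_normalForm (a : A) (r : Fin 2 → ZMod 2) (b : A) :
    rep (normalForm (a, r, b)) =
      rep (incl a) + ∑ i, r i • single (![1, 2] i) 3 1 + rep (incl b) * single 0 3 1 := by
  simp [normalForm_apply, rep_w, d, rep_mk_ι, genMatrix]

theorem eq_zero_of_rep_normalForm_eq_zero {v : A × (Fin 2 → ZMod 2) × A}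
    (hv : rep (normalForm v) = 0) : v = 0 := by
  obtain ⟨a, r, b⟩ := v
  rw [rep_normalForm] at hv
  have hb_lower : ∀ i, i ≠ 0 → rep (incl b) i 0 = 0 := fun i hi =>
    isUpperTriangular_rep _ (Fin.pos_of_ne_zero hi)
  have ha : a = 0 := by simpa [rep_incl_zero_zero] using congrFun₂ hv 0 0
  subst ha
  have hr₀ : r 0 = 0 := by simpa [hb_lower] using congrFun₂ hv 1 3
  have hr₁ : r 1 = 0 := by simpa [hb_lower] using congrFun₂ hv 2 3
  have hb : b = 0 := by simpa [rep_incl_zero_zero] using congrFun₂ hv 0 3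
  have hr : r = 0 := funext (Fin.forall_fin_two.2 ⟨hr₀, hr₁⟩)
  rw [hr, hb, Prod.mk_zero_zero, Prod.mk_zero_zero]

theorem normalForm_injective : Function.Injective normalForm :=
  (injective_iff_map_eq_zero _).2 fun _ hv =>
    eq_zero_of_rep_normalForm_eq_zero (by rw [hv, map_zero])

theorem rep_injective : Function.Injective rep := by
  refine (injective_iff_map_eq_zero _).2 fun s hs => ?_
  obtain ⟨v, rfl⟩ := normalForm_surjective s
  rw [eq_zero_of_rep_normalForm_eq_zero hs, map_zero]

end Representation

theorem detectsRegular_augmentation : DetectsRegular (augmentation : S →+* ZMod 2) := by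
  refine .of_isUpperTriangular (ρ := (rep : S →+* Matrix (Fin 4) (Fin 4) A)) rep_injective
    isUpperTriangular_rep fun i f hf => .of_ne_zero' fun hzero => hf ?_
  ext k
  have hk : rep (f.coeff k) i i = 0 :=
    (coeff_map _ k).symm.trans (by rw [hzero, coeff_zero])
  simpa [hk] using (algebraMapInv_rep_apply_self (f.coeff k) i).symm

theorem mk_d_ne_zero (i : Fin 2) : mk (d i) ≠ 0 := by
  rw [mk_d_eq_normalForm, normalForm_injective.ne_iff' (map_zero _)]
  simp

theorem w_ne_zero : w ≠ 0 := by
  rw [w_eq_normalForm, normalForm_injective.ne_iff' (map_zero _)]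
  simp

theorem eq_zero_of_mk_c_mul_eq_zero {t : S} (ht : ∀ i, mk (c i) * t = 0) : t = 0 := by
  obtain ⟨⟨a, r, b⟩, rfl⟩ := normalForm_surjective t
  have hcoord : ∀ i, x i * a = 0 ∧ algebraMap (ZMod 2) A (r i.rev) + x i * b = 0 := fun i => by
    have hi := ht i
    rw [mk_c_mul_normalForm, map_eq_zero_iff _ normalForm_injective] at hi
    simpa using hi
  have ha : a = 0 := (mul_eq_zero.1 (hcoord 0).1).resolve_left (x_ne_zero 0)
  have hr : ∀ i : Fin 2, r i.rev = 0 := fun i => by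
    simpa [algebraMapInv_x] using congrArg FreeAlgebra.algebraMapInv (hcoord i).2
  have hb : b = 0 := by
    have hxb := (hcoord 0).2
    rw [hr, map_zero, zero_add] at hxb
    exact (mul_eq_zero.1 hxb).resolve_left (x_ne_zero 0)
  have hr_zero : r = 0 := funext fun i => by simpa using hr i.rev
  rw [ha, hb, hr_zero, Prod.mk_zero_zero, Prod.mk_zero_zero, map_zero]

theorem not_isReversibleRing : ¬ IsReversibleRing S := fun h =>
  w_ne_zero (h (mk (d 1)) (mk (c 0)) (mk_d_mul_mk_ι 1 (.c 0)))

theorem not_isRightMcCoy : ¬ IsRightMcCoy S := by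
  intro h
  set f : S[X] := C (mk (c 0)) + C (mk (c 1)) * X with hf
  set g : S[X] := C (mk (d 0)) + C (mk (d 1)) * X with hg
  have hfg : f * g = 0 := by
    rw [hf, hg, C_add_C_mul_X_mul, mk_c_mul_mk_d, mk_c_mul_mk_d_add, mk_c_mul_mk_d]
    simp
  have hf_ne : f ≠ 0 := fun hzero => w_ne_zero <| by
    have hc : mk (c 0) = 0 := by simpa [hf] using congrArg (coeff · 0) hzero
    rw [w, hc, zero_mul]
  have hg_ne : g ≠ 0 := fun hzero => mk_d_ne_zero 0 <| by
    simpa [hg] using congrArg (coeff · 0) hzero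
  obtain ⟨t, ht, hft⟩ := h f g hf_ne hg_ne hfg
  refine ht (eq_zero_of_mk_c_mul_eq_zero (Fin.forall_fin_two.2 ⟨?_, ?_⟩))
  · simpa [hf] using congrArg (coeff · 0) hft
  · simpa [hf, add_mul] using congrArg (coeff · 1) hft

theorem isInnerMcCoy_dut (n : ℕ) [NeZero n] : IsInnerMcCoy (DUT n S) := by
  refine detectsRegular_augmentation.comp_diag.isInnerMcCoy
    (mt DUT.corner_eq_zero_iff.1 (mk_d_ne_zero 0)) fun M hM => ?_
  have hdiag : augmentation (DUT.diag n S M) = 0 := hM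
  rw [DUT.corner_mul, mk_d_mul, hdiag, zero_smul, DUT.corner_eq_zero_iff]

end ExampleRing

theorem mainTheorem11_general (n : ℕ) [NeZero n] :
    ¬ IsReversibleRing (DUT n ExampleRing.S) ∧
    IsIReversibleRing (DUT n ExampleRing.S) ∧
    ¬ IsMcCoy (DUT n ExampleRing.S) ∧
    IsInnerMcCoy (DUT n ExampleRing.S) :=
  ⟨fun h => ExampleRing.not_isReversibleRing (h.of_injective DUT.scalar_injective),
    ExampleRing.detectsRegular_augmentation.comp_diag.isIReversibleRing,
    fun h => ExampleRing.not_isRightMcCoy h.2.of_dut,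
    ExampleRing.isInnerMcCoy_dut n⟩

theorem mainTheorem11 (n : ℕ) (hn : 2 ≤ n) :
    ¬ IsReversibleRing (DUT n ExampleRing.S) ∧
    IsIReversibleRing (DUT n ExampleRing.S) ∧
    ¬ IsMcCoy (DUT n ExampleRing.S) ∧
    IsInnerMcCoy (DUT n ExampleRing.S) :=
  have : NeZero n := ⟨by omega⟩
  mainTheorem11_general n
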